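/- Let $\mathbb{H}^d$ be the space of column vectors over the quaternions, regarded as a right $\mathbb{H}$-vector space with $\langle x,y\rangle=\sum_l \overline{x_l}\,y_l$ and $\|x\|^2=\langle x,x\rangle$; matrices act on the left, and $U_d(\mathbb{H})$ is the group of unitary $d\times d$ quaternionic matrices. A line is a one-dimensional right subspace $x\mathbb{H}$, $x\ne0$. A finite family $(v_j)_{j=1}^n$ of unit vectors in $\mathbb{H}^d$, and the set of lines that it gives, is called a spherical $(t,t)$-design if $$\sum_{j=1}^n\sum_{k=1}^n|\langle v_j,v_k\rangle|^{2t}=c_t(\mathbb{H}^d)\Bigl(\sum_{\ell=1}^n\|v_\ell\|^{2t}\Bigr)^2,\qquad c_t(\mathbb{H}^d):=\prod_{j=0}^{t-1}\frac{2+j}{2d+j},$$ so that $c_3(\mathbb{H}^2)=\frac15$. A reflection is a nonidentity matrix of finite order that fixes pointwise the orthogonal complement of some nonzero vector. Let $$P_1=\Bigl\langle \begin{pmatrix}i&0\\0&1\end{pmatrix},\ \tfrac12\begin{pmatrix}1+j&-1+j\\-1+j&1+j\end{pmatrix}\Bigr\rangle,\quad P_2=\Bigl\langle \begin{pmatrix}i&0\\0&1\end{pmatrix},\begin{pmatrix}j&0\\0&1\end{pmatrix},\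 \tfrac12\begin{pmatrix}1+j&-1+j\\-1+j&1+j\end{pmatrix}\Bigr\rangle,$$ $$P_3=\Bigl\langle \begin{pmatrix}i&0\\0&1\end{pmatrix},\begin{pmatrix}j&0\\0&1\end{pmatrix},\ \tfrac1{\sqrt2}\begin{pmatrix}1&1\\1&-1\end{pmatrix}\Bigr\rangle .$$ **Proposition.** The groups $P_1,P_2,P_3\subset U_2(\mathbb{H})$ are finite, of orders $320$, $1920$, $3840$, and each is generated by the reflections that it contains. For $G=P_1,P_2,P_3$ the following hold. 1. Every orbit of a nonzero vector $x\in\mathbb{H}^2$ is a spherical $(3,3)$-design: both the family $(gx/\|gx\|)_{g\in G}$ and the set of lines $\{(gx)\mathbb{H}:g\in G\}$, with each line taken once, are spherical $(3,3)$-designs. 2. Equivalently, for all $x\in\mathbb{H}^2$, $$p_G^{(3)}(x):=\frac1{|G|}\sum_{g\in G}|\langle x,gx\rangle|^{6}-c_3(\mathbb{H}^2)\,\langle x,x\rangle^{6}=0 .$$ In particular, the five bases $$\Bigl\{\begin{pmatrix}1\\0\end{pmatrix},\begin{pmatrix}0\\1\end{pmatrix}\Bigr\},\qquad \Bigl\{\tfrac1{\sqrt2}\begin{pmatrix}1\\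 q\end{pmatrix},\tfrac1{\sqrt2}\begin{pmatrix}1\\ -q\end{pmatrix}\Bigr\},\quad q=1,i,j,k,$$ of $\mathbb{H}^2$ are mutually unbiased (each is orthonormal, and $|\langle v,w\rangle|^2=\frac12$ for $v,w$ in different bases), they give ten distinct lines, this set of ten lines is the orbit of each of its lines under each of $P_1,P_2,P_3$, and it is a spherical $(3,3)$-design. -/

import Mathlib

open scoped Quaternion Matrix LinearAlgebra.Projectivization

noncomputable section

namespace QDesign

/-- Column vectors in `ℍ^d`. They form a right vector space over `ℍ` (a module over `ℍᵐᵒᵖ`);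
matrices act on the left. -/
abbrev Vec (d : ℕ) : Type := Fin d → ℍ[ℝ]

/-- The group `U_d(ℍ)` of unitary quaternionic `d × d` matrices. -/
abbrev U (d : ℕ) : Type := unitary (Matrix (Fin d) (Fin d) ℍ[ℝ])

/-- The Hermitian inner product `⟨x, y⟩ = ∑ conj(x_l) y_l`, linear in `y` for scalars on the
right. -/
def hInner {d : ℕ} (x y : Vec d) : ℍ[ℝ] := ∑ l, star (x l) * y l

/-- The Euclidean norm on `ℍ^d` (the norm that Mathlib puts on functions is the sup norm). -/
def vecNorm {d : ℕ} (x : Vec d) : ℝ := √(∑ l, ‖x l‖ ^ 2)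

theorem hInner_self {d : ℕ} (x : Vec d) : hInner x x = ((vecNorm x ^ 2 : ℝ) : ℍ[ℝ]) := by
  have h : (0 : ℝ) ≤ ∑ l, ‖x l‖ ^ 2 := Finset.sum_nonneg fun l _ => sq_nonneg _
  have hc : ((∑ l, ‖x l‖ ^ 2 : ℝ) : ℍ[ℝ]) = ∑ l, ((‖x l‖ ^ 2 : ℝ) : ℍ[ℝ]) :=
    map_sum (algebraMap ℝ ℍ[ℝ]) (fun l => ‖x l‖ ^ 2) Finset.univ
  rw [vecNorm, Real.sq_sqrt h, hInner, hc]
  refine Finset.sum_congr rfl fun l _ => ?_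
  rw [Quaternion.star_mul_self, Quaternion.normSq_eq_norm_mul_self, sq]

/-- The unit vector `x / ‖x‖`, for `x ≠ 0`. -/
def normalize {d : ℕ} (x : Vec d) : Vec d := (vecNorm x)⁻¹ • x

/-- The constant `c_t(ℍ^d) = ∏_{j=0}^{t-1} (2 + j) / (2d + j)`. -/
def designConst (t d : ℕ) : ℝ := ∏ j ∈ Finset.range t, (2 + (j : ℝ)) / (2 * (d : ℝ) + (j : ℝ))

/-- A finite family `(v_j)` of unit vectors in `ℍ^d` is a spherical `(t,t)`-design. -/
def IsSphericalDesign {d : ℕ} (t : ℕ) {ι : Type*} [Fintype ι] (v : ι → Vec d) : Prop :=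
  (∀ j, vecNorm (v j) = 1) ∧
    ∑ j, ∑ k, ‖hInner (v j) (v k)‖ ^ (2 * t) =
      designConst t d * (∑ l, vecNorm (v l) ^ (2 * t)) ^ 2

/-- The lines of `ℍ^d`: one-dimensional subspaces of the right `ℍ`-vector space `ℍ^d`. -/
abbrev Line (d : ℕ) : Type := ℙ (ℍ[ℝ]ᵐᵒᵖ) (Vec d)

/-- The line `x ℍ` spanned by a nonzero vector. -/
def lineOf {d : ℕ} (x : Vec d) (hx : x ≠ 0) : Line d := Projectivization.mk (ℍ[ℝ]ᵐᵒᵖ) x hx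

/-- A set of lines is a spherical `(t,t)`-design if it consists of finitely many distinct lines
given by unit vectors `v_1, …, v_n` that form a spherical `(t,t)`-design. -/
def IsLineDesign {d : ℕ} (t : ℕ) (S : Set (Line d)) : Prop :=
  ∃ (n : ℕ) (v : Fin n → Vec d) (hv : ∀ j, v j ≠ 0),
    Function.Injective (fun j => lineOf (v j) (hv j)) ∧
    Set.range (fun j => lineOf (v j) (hv j)) = S ∧
    IsSphericalDesign t v

theorem mulVec_ne_zero {d : ℕ} (g : U d) {x : Vec d} (hx : x ≠ 0) :
    (g : Matrix (Fin d) (Fin d) ℍ[ℝ]) *ᵥ x ≠ 0 := by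
  intro h
  apply hx
  have h2 : (star (g : Matrix (Fin d) (Fin d) ℍ[ℝ]) * (g : Matrix (Fin d) (Fin d) ℍ[ℝ])) *ᵥ x = 0 := by
    rw [← Matrix.mulVec_mulVec, h, Matrix.mulVec_zero]
  rwa [Unitary.star_mul_self_of_mem g.2, Matrix.one_mulVec] at h2

/-- The orbit of the line `x ℍ` under `G`, as a set of lines. -/
def orbitLines {d : ℕ} (G : Subgroup (U d)) (x : Vec d) (hx : x ≠ 0) : Set (Line d) :=
  Set.range fun g : G =>
    lineOf (((g : U d) : Matrix (Fin d) (Fin d) ℍ[ℝ]) *ᵥ x) (mulVec_ne_zero (g : U d) hx)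

/-- `p_G^{(t)}(x) = |G|⁻¹ ∑_{g ∈ G} |⟨x, g x⟩|^{2t} - c_t(ℍ^d) ⟨x, x⟩^{2t}`, where
`⟨x, x⟩ = ‖x‖^2`. -/
def orbitPoly {d : ℕ} (t : ℕ) (G : Subgroup (U d)) [Fintype G] (x : Vec d) : ℝ :=
  (Fintype.card G : ℝ)⁻¹ *
      ∑ g : G, ‖hInner x (((g : U d) : Matrix (Fin d) (Fin d) ℍ[ℝ]) *ᵥ x)‖ ^ (2 * t) -
    designConst t d * (vecNorm x ^ 2) ^ (2 * t)

/-- A quaternionic reflection: a nonidentity matrix of finite order that fixes pointwise a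
hyperplane (the orthogonal complement of a nonzero root vector `a`). -/
def IsReflection {d : ℕ} (g : Matrix (Fin d) (Fin d) ℍ[ℝ]) : Prop :=
  g ≠ 1 ∧ IsOfFinOrder g ∧ ∃ a : Vec d, a ≠ 0 ∧ ∀ x, hInner a x = 0 → g *ᵥ x = x

/-- The quaternion unit `i`. -/
def qi : ℍ[ℝ] := ⟨0, 1, 0, 0⟩

/-- The quaternion unit `j`. -/
def qj : ℍ[ℝ] := ⟨0, 0, 1, 0⟩

/-- The quaternion unit `k`. -/
def qk : ℍ[ℝ] := ⟨0, 0, 0, 1⟩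

/-- The generator `diag(i, 1)`. -/
def matI : Matrix (Fin 2) (Fin 2) ℍ[ℝ] := !![qi, 0; 0, 1]

/-- The generator `diag(j, 1)`. -/
def matJ : Matrix (Fin 2) (Fin 2) ℍ[ℝ] := !![qj, 0; 0, 1]

/-- The non-monomial generator of `P₁` and `P₂`, the reflection of order four with root `(1, 1)`
and scalar `j`. -/
def matR : Matrix (Fin 2) (Fin 2) ℍ[ℝ] :=
  (1 / 2 : ℝ) • !![1 + qj, -1 + qj; -1 + qj, 1 + qj]

/-- The Fourier matrix. -/
def matF : Matrix (Fin 2) (Fin 2) ℍ[ℝ] := (1 / √2 : ℝ) • !![1, 1; 1, -1]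

theorem qi_re : qi.re = 0 := rfl
theorem qi_imI : qi.imI = 1 := rfl
theorem qi_imJ : qi.imJ = 0 := rfl
theorem qi_imK : qi.imK = 0 := rfl

theorem qj_re : qj.re = 0 := rfl
theorem qj_imI : qj.imI = 0 := rfl
theorem qj_imJ : qj.imJ = 1 := rfl
theorem qj_imK : qj.imK = 0 := rfl

theorem star_qi : star qi = -qi := by
  apply Quaternion.ext <;> simp [qi_re, qi_imI, qi_imJ, qi_imK]

theorem star_qj : star qj = -qj := by
  apply Quaternion.ext <;> simp [qj_re, qj_imI, qj_imJ, qj_imK]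

theorem qi_mul_qi : qi * qi = -1 := by
  apply Quaternion.ext <;> simp [qi_re, qi_imI, qi_imJ, qi_imK]

theorem qj_mul_qj : qj * qj = -1 := by
  apply Quaternion.ext <;> simp [qj_re, qj_imI, qj_imJ, qj_imK]

theorem matI_mem : matI ∈ unitary (Matrix (Fin 2) (Fin 2) ℍ[ℝ]) := by
  rw [Unitary.mem_iff, Matrix.star_eq_conjTranspose]
  constructor <;>
  · rw [← Matrix.ext_iff]
    simp [matI, Fin.forall_fin_two, Matrix.mul_apply, Matrix.conjTranspose_apply, star_qi,
      qi_mul_qi]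

theorem matJ_mem : matJ ∈ unitary (Matrix (Fin 2) (Fin 2) ℍ[ℝ]) := by
  rw [Unitary.mem_iff, Matrix.star_eq_conjTranspose]
  constructor <;>
  · rw [← Matrix.ext_iff]
    simp [matJ, Fin.forall_fin_two, Matrix.mul_apply, Matrix.conjTranspose_apply, star_qj,
      qj_mul_qj]

theorem matR_mem : matR ∈ unitary (Matrix (Fin 2) (Fin 2) ℍ[ℝ]) := by
  rw [Unitary.mem_iff, Matrix.star_eq_conjTranspose]
  constructor <;>
  · rw [← Matrix.ext_iff]
    simp [matR, Fin.forall_fin_two, Matrix.mul_apply, Matrix.conjTranspose_apply, star_qj,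
      mul_add, add_mul, qj_mul_qj]
    refine ⟨⟨?_, ?_⟩, ?_, ?_⟩ <;> module

theorem matF_mem : matF ∈ unitary (Matrix (Fin 2) (Fin 2) ℍ[ℝ]) := by
  have h : (√2 : ℝ)⁻¹ * (√2)⁻¹ = 1 / 2 := by
    rw [← mul_inv, Real.mul_self_sqrt (by norm_num)]; norm_num
  rw [Unitary.mem_iff, Matrix.star_eq_conjTranspose]
  constructor <;>
  · rw [← Matrix.ext_iff]
    simp [matF, Fin.forall_fin_two, Matrix.mul_apply, Matrix.conjTranspose_apply, smul_smul, h]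
    module

/-- The group `P₁` of order 320. -/
def P₁ : Subgroup (U 2) := Subgroup.closure {⟨matI, matI_mem⟩, ⟨matR, matR_mem⟩}

/-- The group `P₂` of order 1920. -/
def P₂ : Subgroup (U 2) :=
  Subgroup.closure {⟨matI, matI_mem⟩, ⟨matJ, matJ_mem⟩, ⟨matR, matR_mem⟩}

/-- The group `P₃` of order 3840. -/
def P₃ : Subgroup (U 2) :=
  Subgroup.closure {⟨matI, matI_mem⟩, ⟨matJ, matJ_mem⟩, ⟨matF, matF_mem⟩}

/-- A collection of mutually unbiased bases of `ℍ^d`: each `B m` is an orthonormal basis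
(`d` orthonormal vectors), and vectors in different bases satisfy `|⟨v, w⟩|^2 = 1/d`. -/
def IsMUB {d : ℕ} {κ : Type*} (B : κ → Fin d → Vec d) : Prop :=
  (∀ m a b, hInner (B m a) (B m b) = if a = b then 1 else 0) ∧
    ∀ m n, m ≠ n → ∀ a b, ‖hInner (B m a) (B n b)‖ ^ 2 = 1 / (d : ℝ)

/-- The five quaternionic bases of `ℍ^2`: the standard basis, and
`{(1, q)/√2, (1, -q)/√2}` for `q = 1, i, j, k`. -/
def mub : Fin 5 → Fin 2 → Vec 2 :=
  ![![![1, 0], ![0, 1]],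
    ![(1 / √2 : ℝ) • ![1, 1], (1 / √2 : ℝ) • ![1, -1]],
    ![(1 / √2 : ℝ) • ![1, qi], (1 / √2 : ℝ) • ![1, -qi]],
    ![(1 / √2 : ℝ) • ![1, qj], (1 / √2 : ℝ) • ![1, -qj]],
    ![(1 / √2 : ℝ) • ![1, qk], (1 / √2 : ℝ) • ![1, -qk]]]

theorem mub_ne_zero (m : Fin 5) (a : Fin 2) : mub m a ≠ 0 := by
  fin_cases m <;> fin_cases a <;> simp [mub]

/-- The set of lines given by the ten vectors of the five bases. -/
def mubLines : Set (Line 2) :=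
  Set.range fun p : Fin 5 × Fin 2 => lineOf (mub p.1 p.2) (mub_ne_zero p.1 p.2)

end QDesign

end

open scoped Quaternion Matrix LinearAlgebra.Projectivization

noncomputable section

namespace QDesign

/-! The Hopf map sends unit vectors of ℍ² to S⁴ ⊂ ℝ⁵, its fibres there are the unit vectors of
single lines, and 2|⟨x,y⟩|² = ‖x‖²‖y‖² + hopf x · hopf y (`two_mul_norm_hInner_sq`). Hence |⟨x,y⟩|⁶
is a cubic polynomial in hopf y, and the design identity follows once the images in ℝ⁵ have the
moments of a sphere up to degree three.

Each generator acts on ℝ⁵ as a signed permutation of determinant one. The groups permute the five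
coordinates transitively and realize every even sign change; `IsSignedPermCover` records this. Even
sign changes kill the moments of degrees one and three and the mixed second moments, and
transitivity makes the pure second moments equal. So every orbit integrates cubics like the sphere
(`IsFlipInvariant.sum_add_pow_three`, `IsSignedPermCover.sum_norm_hInner`).

For the orders, only ±1 act trivially on ℝ⁵ and there are 16 even sign changes, so |G| = 2·16·|H|
with H the permutation group: dihedral of order 10, A₅ and S₅ (`IsSignedPermCover.natCard_eq`). The
five bases lie over the points ±e_m, which the signed permutations permute transitively. -/

/-! ### The Hopf map -/

/-- The Hopf map from `ℍ²` to `ℝ⁵`, which identifies the lines of `ℍ²` with the sphere `S⁴`. -/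
def hopf (x : Vec 2) : Fin 5 → ℝ :=
  ![Quaternion.normSq (x 0) - Quaternion.normSq (x 1), 2 * (x 1 * star (x 0)).re,
    2 * (x 1 * star (x 0)).imI, 2 * (x 1 * star (x 0)).imJ, 2 * (x 1 * star (x 0)).imK]

theorem vecNorm_nonneg {d : ℕ} (x : Vec d) : 0 ≤ vecNorm x := Real.sqrt_nonneg _

theorem vecNorm_sq {d : ℕ} (x : Vec d) : vecNorm x ^ 2 = ∑ l, Quaternion.normSq (x l) := by
  rw [vecNorm, Real.sq_sqrt (Finset.sum_nonneg fun l _ => sq_nonneg _)]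
  simp [Quaternion.normSq_eq_norm_mul_self, sq]

theorem vecNorm_eq_zero {d : ℕ} {x : Vec d} : vecNorm x = 0 ↔ x = 0 := by
  rw [← sq_eq_zero_iff, vecNorm_sq, Finset.sum_eq_zero_iff_of_nonneg
    fun _ _ => Quaternion.normSq_nonneg]
  simp [funext_iff]

theorem vecNorm_pos {d : ℕ} {x : Vec d} (hx : x ≠ 0) : 0 < vecNorm x :=
  (vecNorm_nonneg x).lt_of_ne' fun h => hx (vecNorm_eq_zero.1 h)

theorem hInner_mulVec {d : ℕ} (g : U d) (x y : Vec d) :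
    hInner ((g : Matrix (Fin d) (Fin d) ℍ[ℝ]) *ᵥ x) ((g : Matrix (Fin d) (Fin d) ℍ[ℝ]) *ᵥ y) =
      hInner x y := by
  change star ((g : Matrix (Fin d) (Fin d) ℍ[ℝ]) *ᵥ x) ⬝ᵥ _ = star x ⬝ᵥ y
  rw [Matrix.star_mulVec, Matrix.dotProduct_mulVec, Matrix.vecMul_vecMul,
    ← Matrix.star_eq_conjTranspose, Unitary.star_mul_self_of_mem g.2, Matrix.vecMul_one]

theorem vecNorm_mulVec {d : ℕ} (g : U d) (x : Vec d) :
    vecNorm ((g : Matrix (Fin d) (Fin d) ℍ[ℝ]) *ᵥ x) = vecNorm x := by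
  have h := hInner_mulVec g x x
  rw [hInner_self, hInner_self, Quaternion.coe_inj] at h
  exact (sq_eq_sq₀ (vecNorm_nonneg _) (vecNorm_nonneg _)).1 h

theorem vecNorm_smul {d : ℕ} (r : ℝ) (x : Vec d) : vecNorm (r • x) = |r| * vecNorm x := by
  rw [← sq_eq_sq₀ (vecNorm_nonneg _) (mul_nonneg (abs_nonneg _) (vecNorm_nonneg _)), mul_pow,
    vecNorm_sq, vecNorm_sq, sq_abs, Finset.mul_sum]
  simp [Quaternion.normSq_smul]

theorem vecNorm_op_smul {d : ℕ} (q : ℍ[ℝ]ᵐᵒᵖ) (x : Vec d) :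
    vecNorm (q • x) ^ 2 = Quaternion.normSq q.unop * vecNorm x ^ 2 := by
  rw [vecNorm_sq, vecNorm_sq, Finset.mul_sum]
  simp [MulOpposite.smul_eq_mul_unop, mul_comm]

theorem vecNorm_normalize {d : ℕ} {x : Vec d} (hx : x ≠ 0) : vecNorm (normalize x) = 1 := by
  rw [normalize, vecNorm_smul, abs_of_nonneg (inv_nonneg.2 (vecNorm_nonneg x)),
    inv_mul_cancel₀ (vecNorm_pos hx).ne']

theorem ne_zero_of_vecNorm_eq_one {d : ℕ} {x : Vec d} (hx : vecNorm x = 1) : x ≠ 0 := by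
  rintro rfl
  rw [vecNorm_eq_zero.2 rfl] at hx
  exact zero_ne_one hx

theorem normalize_ne_zero {d : ℕ} {x : Vec d} (hx : x ≠ 0) : normalize x ≠ 0 :=
  ne_zero_of_vecNorm_eq_one (vecNorm_normalize hx)

theorem hopf_smul (r : ℝ) (x : Vec 2) : hopf (r • x) = r ^ 2 • hopf x := by
  ext i
  fin_cases i <;> simp [hopf, Quaternion.normSq_smul] <;> ring

/-- A right scalar cancels up to its norm in (x₁q)(x₀q)* = |q|² x₁x₀*, so on unit vectors the Hopf
map depends only on the line. -/
theorem hopf_op_smul (q : ℍ[ℝ]ᵐᵒᵖ) (x : Vec 2) :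
    hopf (q • x) = Quaternion.normSq q.unop • hopf x := by
  have h : x 1 * q.unop * (star q.unop * star (x 0)) =
      Quaternion.normSq q.unop • (x 1 * star (x 0)) := by
    rw [mul_assoc, ← mul_assoc q.unop, Quaternion.self_mul_star, Quaternion.coe_mul_eq_smul,
      mul_smul_comm]
  ext i
  fin_cases i <;> simp only [hopf, Pi.smul_apply, MulOpposite.smul_eq_mul_unop, star_mul, h,
    map_mul] <;> simp <;> ring

/-- The absolute value of the inner product in terms of the Hopf map. -/
theorem two_mul_norm_hInner_sq (x y : Vec 2) :
    2 * ‖hInner x y‖ ^ 2 = vecNorm x ^ 2 * vecNorm y ^ 2 + ∑ i, hopf x i * hopf y i := by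
  rw [sq ‖_‖, ← Quaternion.normSq_eq_norm_mul_self, vecNorm_sq, vecNorm_sq]
  simp only [hInner, hopf, Fin.sum_univ_two, Fin.sum_univ_five, Quaternion.normSq_def']
  simp
  ring

theorem sum_hopf_sq (x : Vec 2) : ∑ i, hopf x i ^ 2 = (vecNorm x ^ 2) ^ 2 := by
  rw [vecNorm_sq]
  simp only [hopf, Fin.sum_univ_two, Fin.sum_univ_five, Quaternion.normSq_def']
  simp
  ring

/-- Vectors of the same norm with the same image under the Hopf map differ by a scalar. -/
theorem exists_op_smul_eq {x y : Vec 2} (hx : x ≠ 0) (hn : vecNorm x = vecNorm y)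
    (h : hopf x = hopf y) : ∃ q : ℍ[ℝ]ᵐᵒᵖ, q • x = y := by
  have hn2 : vecNorm x ^ 2 = vecNorm y ^ 2 := by rw [hn]
  rw [vecNorm_sq, vecNorm_sq, Fin.sum_univ_two, Fin.sum_univ_two] at hn2
  have h0 : Quaternion.normSq (x 0) - Quaternion.normSq (x 1) =
    Quaternion.normSq (y 0) - Quaternion.normSq (y 1) := congrFun h 0
  have hq : x 1 * star (x 0) = y 1 * star (y 0) := by
    have h1 : 2 * (x 1 * star (x 0)).re = 2 * (y 1 * star (y 0)).re := congrFun h 1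
    have h2 : 2 * (x 1 * star (x 0)).imI = 2 * (y 1 * star (y 0)).imI := congrFun h 2
    have h3 : 2 * (x 1 * star (x 0)).imJ = 2 * (y 1 * star (y 0)).imJ := congrFun h 3
    have h4 : 2 * (x 1 * star (x 0)).imK = 2 * (y 1 * star (y 0)).imK := congrFun h 4
    apply Quaternion.ext <;> linarith
  -- The norm gives the sum of the two squared moduli and the zeroth Hopf coordinate their
  -- difference.
  have hx0 : Quaternion.normSq (x 0) = Quaternion.normSq (y 0) := by linarith
  by_cases hz : x 0 = 0
  · have hy : y 0 = 0 := by rwa [← Quaternion.normSq_eq_zero, ← hx0, Quaternion.normSq_eq_zero]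
    have hx1 : x 1 ≠ 0 := fun h1 => hx (by ext1 i; fin_cases i <;> assumption)
    refine ⟨MulOpposite.op ((x 1)⁻¹ * y 1), ?_⟩
    ext1 i
    fin_cases i
    · simp [hz, hy]
    · simp [hx1]
  -- The scalar is forced by the first entry; the second then agrees because x₁x₀* = y₁y₀* and |x₀|
  -- = |y₀|.
  · refine ⟨MulOpposite.op ((x 0)⁻¹ * y 0), ?_⟩
    ext1 i
    fin_cases i
    · simp [hz]
    · have hz' : Quaternion.normSq (y 0) ≠ 0 := by rw [← hx0]; simpa using hz
      have : x 1 * ((x 0)⁻¹ * y 0) = y 1 := by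
        have hinv : (x 0)⁻¹ = (Quaternion.normSq (x 0))⁻¹ • star (x 0) := rfl
        rw [hinv, hx0, smul_mul_assoc, mul_smul_comm, ← mul_assoc, hq, mul_assoc, Quaternion.star_mul_self,
          Quaternion.mul_coe_eq_smul, smul_smul, inv_mul_cancel₀ hz', one_smul]
      simpa using this

theorem lineOf_eq_of_hopf {x y : Vec 2} (hx : x ≠ 0) (hy : y ≠ 0) (hn : vecNorm x = vecNorm y)
    (h : hopf x = hopf y) : lineOf x hx = lineOf y hy := by
  obtain ⟨q, hq⟩ := exists_op_smul_eq hx hn h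
  exact ((Projectivization.mk_eq_mk_iff' _ _ _ hy hx).2 ⟨q, hq⟩).symm

theorem hopf_eq_of_lineOf {x y : Vec 2} (hx : x ≠ 0) (hy : y ≠ 0) (hn : vecNorm x = vecNorm y)
    (h : lineOf x hx = lineOf y hy) : hopf x = hopf y := by
  obtain ⟨q, rfl⟩ := (Projectivization.mk_eq_mk_iff' _ _ _ hx hy).1 h
  have h1 := vecNorm_op_smul q y
  rw [hn] at h1
  have h2 := vecNorm_pos hy
  have h3 : Quaternion.normSq q.unop = 1 :=
    mul_right_cancel₀ (pow_ne_zero 2 h2.ne') (h1.symm.trans (one_mul _).symm)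
  rw [hopf_op_smul, h3, one_smul]

theorem lineOf_normalize {d : ℕ} {x : Vec d} (hx : x ≠ 0) :
    lineOf (normalize x) (normalize_ne_zero hx) = lineOf x hx := by
  refine (Projectivization.mk_eq_mk_iff' _ _ _ _ hx).2
    ⟨MulOpposite.op ((vecNorm x)⁻¹ : ℝ), ?_⟩
  ext1 i
  exact Quaternion.mul_coe_eq_smul _ _


/-! ### Signed permutations of the coordinates of the Hopf map -/

theorem qk_re : qk.re = 0 := rfl
theorem qk_imI : qk.imI = 0 := rfl
theorem qk_imJ : qk.imJ = 0 := rfl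
theorem qk_imK : qk.imK = 1 := rfl

/-- The ten basis vectors lie over the vertices ±e_m of the cross-polytope, one antipodal pair for
each basis. All later facts about the bases are read off from this. -/
theorem hopf_mub_zero (m : Fin 5) : hopf (mub m 0) = Pi.single m 1 := by
  ext i
  fin_cases m <;> fin_cases i <;>
    simp [mub] <;>
    simp [hopf, Quaternion.normSq_def', qi_re, qi_imI, qi_imJ, qi_imK, qj_re,
      qj_imI, qj_imJ, qj_imK, qk_re, qk_imI, qk_imJ, qk_imK, ← mul_inv]

theorem hopf_mub_one (m : Fin 5) : hopf (mub m 1) = -Pi.single m 1 := by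
  ext i
  fin_cases m <;> fin_cases i <;>
    simp [mub] <;>
    simp [hopf, Quaternion.normSq_def', qi_re, qi_imI, qi_imJ, qi_imK, qj_re,
      qj_imI, qj_imJ, qj_imK, qk_re, qk_imI, qk_imJ, qk_imK, ← mul_inv]

theorem vecNorm_mub (m : Fin 5) (a : Fin 2) : vecNorm (mub m a) = 1 := by
  have h : ∑ i, hopf (mub m a) i ^ 2 = 1 := by
    fin_cases a
    · simp [hopf_mub_zero, Pi.single_apply]
    · simp [hopf_mub_one, Pi.single_apply]
  rw [sum_hopf_sq] at h
  have h0 := vecNorm_nonneg (mub m a)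
  rwa [pow_eq_one_iff_of_nonneg (by positivity) two_ne_zero,
    pow_eq_one_iff_of_nonneg h0 two_ne_zero] at h

/-- The unitary matrix `g` acts on the coordinates of the Hopf map by the permutation `σ`
and the signs `ε`. -/
def ActsBy (g : U 2) (ε : Fin 5 → ℤˣ) (σ : Equiv.Perm (Fin 5)) : Prop :=
  ∀ x i, hopf ((g : Matrix (Fin 2) (Fin 2) ℍ[ℝ]) *ᵥ x) (σ i) = ((ε i : ℤ) : ℝ) * hopf x i

namespace ActsBy

variable {g h : U 2} {ε δ : Fin 5 → ℤˣ} {σ τ : Equiv.Perm (Fin 5)}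

theorem one : ActsBy 1 1 1 := fun x i => by simp

theorem mul (hg : ActsBy g ε σ) (hh : ActsBy h δ τ) :
    ActsBy (g * h) (fun i => ε (τ i) * δ i) (σ * τ) := fun x i => by
  rw [Submonoid.coe_mul, ← Matrix.mulVec_mulVec, Equiv.Perm.mul_apply, hg, hh]
  push_cast
  ring

theorem sign_mul_self (u : ℤˣ) : ((u : ℤ) : ℝ) * ((u : ℤ) : ℝ) = 1 := by
  rcases Int.units_eq_one_or u with rfl | rfl <;> simp

theorem apply_inv_self (σ : Equiv.Perm (Fin 5)) (i : Fin 5) : σ (σ⁻¹ i) = i :=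
  σ.apply_symm_apply i

theorem inv (hg : ActsBy g ε σ) : ActsBy g⁻¹ (fun i => ε (σ⁻¹ i)) σ⁻¹ := fun x i => by
  have h := hg (((g⁻¹ : U 2) : Matrix (Fin 2) (Fin 2) ℍ[ℝ]) *ᵥ x) (σ⁻¹ i)
  rw [Matrix.mulVec_mulVec, ← Submonoid.coe_mul, mul_inv_cancel, OneMemClass.coe_one,
    Matrix.one_mulVec, apply_inv_self] at h
  rw [h, ← mul_assoc, sign_mul_self, one_mul]

/-- The image of the Hopf map contains every e_m, and a signed permutation is determined by its
values on these. -/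
theorem unique (hg : ActsBy g ε σ) (hg' : ActsBy g δ τ) : ε = δ ∧ σ = τ := by
  have hne (u : ℤˣ) : ((u : ℤ) : ℝ) ≠ 0 := by exact_mod_cast u.ne_zero
  have key (m : Fin 5) : σ m = τ m := by
    by_contra hm
    have h1 := hg (mub m 0) (σ⁻¹ (τ m))
    rw [apply_inv_self, hg', hopf_mub_zero, Pi.single_eq_same,
      Pi.single_eq_of_ne (fun h => hm (Equiv.Perm.inv_eq_iff_eq.1 h).symm), mul_zero,
      mul_one] at h1
    exact hne _ h1
  have hσ : σ = τ := Equiv.ext key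
  refine ⟨funext fun m => ?_, hσ⟩
  subst hσ
  have h1 := (hg (mub m 0) m).symm.trans (hg' (mub m 0) m)
  rw [hopf_mub_zero, Pi.single_eq_same, mul_one, mul_one] at h1
  exact Units.ext (by exact_mod_cast h1)

end ActsBy

/-- The centre of ℍ is ℝ, and i and j generate ℍ. -/
theorem Quaternion.eq_coe_of_commute {q : ℍ[ℝ]} (hi : q * qi = qi * q) (hj : q * qj = qj * q) :
    q = (q.re : ℍ[ℝ]) := by
  have h1 := congrArg QuaternionAlgebra.imJ hi
  have h2 := congrArg QuaternionAlgebra.imK hi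
  have h3 := congrArg QuaternionAlgebra.imK hj
  simp [qi_re, qi_imI, qi_imJ, qi_imK, qj_re, qj_imI, qj_imJ, qj_imK] at h1 h2 h3
  apply Quaternion.ext <;> simp <;> linarith

theorem coe_neg_one : ((-1 : U 2) : Matrix (Fin 2) (Fin 2) ℍ[ℝ]) = -1 := rfl

/-- The only unitary matrices that act trivially on all lines are `1` and `-1`. -/
theorem ActsBy.eq_one_or_neg_one {g : U 2} (hg : ActsBy g 1 1) : g = 1 ∨ g = -1 := by
  have hx (x : Vec 2) : hopf ((g : Matrix (Fin 2) (Fin 2) ℍ[ℝ]) *ᵥ x) = hopf x :=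
    funext fun i => by simpa using hg x i
  have hline (x : Vec 2) (h : x ≠ 0) :
      ∃ q : ℍ[ℝ]ᵐᵒᵖ, q • x = (g : Matrix (Fin 2) (Fin 2) ℍ[ℝ]) *ᵥ x :=
    exists_op_smul_eq h (vecNorm_mulVec g x).symm (hx x).symm
  -- Every line is fixed. The two coordinate lines make `g` diagonal with entries a, b; the line of
  -- (1, q) gives bq = qa. Then q = 1 yields a = b, and q = i, j make it real, hence ±1 by
  -- unitarity.
  obtain ⟨a, ha⟩ := hline ![1, 0] (by simp)
  obtain ⟨b, hb⟩ := hline ![0, 1] (by simp)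
  have h00 := congrFun ha 0
  have h10 := congrFun ha 1
  have h01 := congrFun hb 0
  have h11 := congrFun hb 1
  simp [Matrix.mulVec, dotProduct] at h00 h10 h01 h11
  have hq (q : ℍ[ℝ]) : b.unop * q = q * a.unop := by
    obtain ⟨c, hc⟩ := hline ![1, q] (by simp)
    have h0 := congrFun hc 0
    have h1 := congrFun hc 1
    simp [Matrix.mulVec, dotProduct, ← h00, ← h10, ← h01, ← h11] at h0 h1
    rw [← h1, h0]
  have hab : b.unop = a.unop := by simpa using hq 1
  rw [hab] at hq h11
  have hre := Quaternion.eq_coe_of_commute (hq qi) (hq qj)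
  have hn : vecNorm (a • (![1, 0] : Vec 2)) ^ 2 = vecNorm (![1, 0] : Vec 2) ^ 2 := by
    rw [ha, vecNorm_mulVec]
  rw [vecNorm_op_smul, hre, Quaternion.normSq_coe] at hn
  have h1 : vecNorm (![1, 0] : Vec 2) ^ 2 = 1 := by simp [vecNorm_sq]
  rw [h1, mul_one, sq_eq_one_iff] at hn
  refine hn.imp (fun h => ?_) (fun h => ?_) <;>
  · rw [h] at hre
    refine Subtype.ext (Matrix.ext fun i j => ?_)
    rw [hre] at h00 h11
    fin_cases i <;> fin_cases j <;> simp [coe_neg_one, ← h00, ← h10, ← h01, ← h11]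

/-- The signs that leave the coordinate `m` fixed and change all others. -/
def flipExcept (m : Fin 5) : Fin 5 → ℤˣ := fun i => if i = m then 1 else -1

/-- The group `G` acts on the coordinates of the Hopf map by the signed permutations of
determinant one with underlying permutation in the transitive group `H`. -/
structure IsSignedPermCover (G : Subgroup (U 2)) (H : Subgroup (Equiv.Perm (Fin 5))) : Prop where
  acts : ∀ g ∈ G, ∃ ε, ∃ σ ∈ H, ActsBy g ε σ ∧ (∏ i, ε i) * Equiv.Perm.sign σ = 1
  lift : ∀ σ ∈ H, ∃ g ∈ G, ∃ ε, ActsBy g ε σ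
  transitive : ∀ i j, ∃ σ ∈ H, σ i = j
  neg_one_mem : -1 ∈ G
  flip_mem : ∃ g ∈ G, ∃ m, ActsBy g (flipExcept m) 1

theorem neg_one_actsBy : ActsBy (-1) 1 1 := fun x i => by
  have h : (((-1 : U 2) : Matrix (Fin 2) (Fin 2) ℍ[ℝ])) *ᵥ x = (-1 : ℝ) • x := by
    rw [coe_neg_one, Matrix.neg_mulVec, Matrix.one_mulVec, neg_one_smul]
  rw [h, hopf_smul]
  simp

/-- An even sign vector has an odd number of entries 1. Position i receives a factor -1 from each m
≠ i with ε m = 1: an even number of them if ε i = 1, an odd number otherwise. So these flips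
generate all even sign changes. -/
theorem eq_prod_flipExcept : ∀ ε : Fin 5 → ℤˣ, ∏ i, ε i = 1 →
    ε = ∏ m, if ε m = 1 then flipExcept m else 1 := by
  decide

namespace IsSignedPermCover

variable {G : Subgroup (U 2)} {H : Subgroup (Equiv.Perm (Fin 5))}

/-- Conjugation by an element that carries m to n moves the exceptional coordinate; the conjugator's
own signs occur twice and cancel. -/
theorem exists_flipExcept (hG : IsSignedPermCover G H) (n : Fin 5) :
    ∃ g ∈ G, ActsBy g (flipExcept n) 1 := by
  obtain ⟨s, hs, m, hsm⟩ := hG.flip_mem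
  obtain ⟨σ, hσ, hmn⟩ := hG.transitive m n
  obtain ⟨g, hg, ε, hgε⟩ := hG.lift σ hσ
  refine ⟨g * s * g⁻¹, G.mul_mem (G.mul_mem hg hs) (G.inv_mem hg), ?_⟩
  convert (hgε.mul hsm).mul hgε.inv using 1
  · ext1 i
    have : σ⁻¹ i = m ↔ i = n := by rw [Equiv.Perm.inv_eq_iff_eq, hmn]
    simp only [flipExcept, this, Equiv.Perm.one_apply]
    rw [mul_right_comm, Int.units_mul_self, one_mul]
  · simp

theorem exists_signs (hG : IsSignedPermCover G H) (ε : Fin 5 → ℤˣ) (hε : ∏ i, ε i = 1) :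
    ∃ g ∈ G, ActsBy g ε 1 := by
  let M : Submonoid (Fin 5 → ℤˣ) :=
    { carrier := {δ | ∃ g ∈ G, ActsBy g δ 1}
      one_mem' := ⟨1, G.one_mem, ActsBy.one⟩
      mul_mem' := by
        rintro δ δ' ⟨g, hg, h⟩ ⟨g', hg', h'⟩
        exact ⟨g * g', G.mul_mem hg hg', h.mul h'⟩ }
  have : ε ∈ M := by
    rw [eq_prod_flipExcept ε hε]
    refine Submonoid.prod_mem M fun m _ => ?_
    split_ifs
    exacts [hG.exists_flipExcept m, M.one_mem]
  exact this

/-- Two successive quotients: G maps onto H, the kernel maps onto the 16 even sign vectors (the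
determinant condition forces evenness), and what remains is {1, -1}. -/
theorem natCard_eq (hG : IsSignedPermCover G H) : Nat.card G = 32 * Nat.card H := by
  choose ε σ hσ hact hpar using fun g : G => hG.acts g g.2
  let f : G →* Equiv.Perm (Fin 5) :=
    MonoidHom.mk' σ fun a b => ((hact (a * b)).unique ((hact a).mul (hact b))).2
  have hker (g : f.ker) : σ g.1 = 1 := g.2
  let k : f.ker →* (Fin 5 → ℤˣ) := MonoidHom.mk' (fun g => ε g.1) fun a b => by
    refine ((hact (a * b : f.ker).1).unique ((hact a.1).mul (hact b.1))).1.trans ?_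
    rw [hker b]
    rfl
  have hrange : f.range = H := by
    ext τ
    constructor
    · rintro ⟨g, rfl⟩
      exact hσ g
    · intro hτ
      obtain ⟨g, hg, δ, hgδ⟩ := hG.lift τ hτ
      exact ⟨⟨g, hg⟩, ((hact ⟨g, hg⟩).unique hgδ).2⟩
  have hk : (k.range : Set (Fin 5 → ℤˣ)) = {δ | ∏ i, δ i = 1} := by
    ext δ
    constructor
    · rintro ⟨g, rfl⟩
      have := hpar g.1
      rwa [hker g, Equiv.Perm.sign_one, mul_one] at this
    · intro hδ
      obtain ⟨g, hg, hgδ⟩ := hG.exists_signs δ hδ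
      have h := (hact ⟨g, hg⟩).unique hgδ
      exact ⟨⟨⟨g, hg⟩, h.2⟩, h.1⟩
  have hk16 : Nat.card k.range = 16 := by
    have h : Nat.card k.range = Nat.card {δ : Fin 5 → ℤˣ // ∏ i, δ i = 1} :=
      Nat.card_congr (Equiv.setCongr hk)
    rw [h, Nat.card_eq_fintype_card]
    decide
  have hk2 : Nat.card k.ker = 2 := by
    have hone : (1 : U 2) ≠ -1 := fun h => by
      have := congrArg (fun g : U 2 => ((g : Matrix (Fin 2) (Fin 2) ℍ[ℝ]) 0 0).re) h
      norm_num [coe_neg_one] at this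
    have h : (fun g : k.ker => ((g.1.1 : G) : U 2)) '' Set.univ = {1, -1} := by
      ext g
      simp only [Set.image_univ, Set.mem_range, Set.mem_insert_iff, Set.mem_singleton_iff]
      constructor
      · rintro ⟨g, rfl⟩
        have h := hact g.1.1
        rw [hker g.1, show ε g.1.1 = 1 from g.2] at h
        exact h.eq_one_or_neg_one
      · intro hg
        have hmem : g ∈ G := by
          rcases hg with rfl | rfl
          exacts [G.one_mem, hG.neg_one_mem]
        have hga : ActsBy g 1 1 := by
          rcases hg with rfl | rfl
          exacts [ActsBy.one, neg_one_actsBy]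
        have h := (hact ⟨g, hmem⟩).unique hga
        exact ⟨⟨⟨⟨g, hmem⟩, h.2⟩, h.1⟩, rfl⟩
    rw [← Set.ncard_univ, ← Set.ncard_image_of_injective (f := fun g : k.ker => ((g.1.1 : G) : U 2))
      _ (fun a b hab => Subtype.ext (Subtype.ext (Subtype.ext hab))), h, Set.ncard_pair hone]
  rw [← Subgroup.card_mul_index f.ker, Subgroup.index_ker, hrange,
    ← Subgroup.card_mul_index k.ker, Subgroup.index_ker, hk16, hk2]

theorem finite (hG : IsSignedPermCover G H) : Finite G := by
  refine Nat.finite_of_card_ne_zero ?_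
  rw [hG.natCard_eq]
  exact mul_ne_zero (by norm_num) Nat.card_pos.ne'

end IsSignedPermCover

/-! ### Designs -/

theorem designConst_three_two : designConst 3 2 = 1 / 5 := by
  norm_num [designConst, Finset.prod_range_succ]

/-- Three indices cannot exhaust five coordinates; for m outside them all three factors are -1. -/
theorem exists_flipExcept_mul_mul_eq : ∀ a b c : Fin 5, ∃ m,
    flipExcept m a * flipExcept m b * flipExcept m c = -1 := by
  decide

theorem exists_flipExcept_mul_eq : ∀ a b : Fin 5, a ≠ b → ∃ m,
    flipExcept m a * flipExcept m b = -1 := by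
  decide

theorem exists_flipExcept_eq : ∀ a : Fin 5, ∃ m, flipExcept m a = -1 := by
  decide

theorem sum_eq_zero_of_perm {ι : Type*} [Fintype ι] {f : ι → ℝ} (τ : Equiv.Perm ι)
    (h : ∀ j, f (τ j) = -f j) : ∑ j, f j = 0 := by
  have h1 := Equiv.sum_comp τ f
  simp only [h, Finset.sum_neg_distrib] at h1
  linarith

theorem exists_even_signs : ∀ (w : ℤˣ) (m : Fin 5), ∃ δ : Fin 5 → ℤˣ, ∏ i, δ i = 1 ∧ δ m = w := by
  decide

/-! ### Moments up to degree three of sign-invariant families in ℝ⁵ -/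

section Moments

variable {ι : Type*} [Fintype ι] {u : ι → Fin 5 → ℝ}

/-- Invariance of a finite family in `ℝ⁵` under the sign changes `flipExcept`. -/
def IsFlipInvariant (u : ι → Fin 5 → ℝ) : Prop :=
  ∀ m, ∃ τ : Equiv.Perm ι, ∀ j i, u (τ j) i = ((flipExcept m i : ℤ) : ℝ) * u j i

theorem IsFlipInvariant.sum_eq_zero (hu : IsFlipInvariant u) (a : Fin 5) :
    ∑ j, u j a = 0 := by
  obtain ⟨m, hm⟩ := exists_flipExcept_eq a
  obtain ⟨τ, hτ⟩ := hu m
  exact sum_eq_zero_of_perm τ fun j => by simp [hτ, hm]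

theorem IsFlipInvariant.sum_mul_eq_zero (hu : IsFlipInvariant u) {a b : Fin 5} (hab : a ≠ b) :
    ∑ j, u j a * u j b = 0 := by
  obtain ⟨m, hm⟩ := exists_flipExcept_mul_eq a b hab
  obtain ⟨τ, hτ⟩ := hu m
  have hm' : ((flipExcept m a : ℤ) : ℝ) * ((flipExcept m b : ℤ) : ℝ) = -1 := by
    simpa using congrArg (fun w : ℤˣ => ((w : ℤ) : ℝ)) hm
  exact sum_eq_zero_of_perm τ fun j => by
    rw [hτ, hτ]
    linear_combination u j a * u j b * hm'

theorem IsFlipInvariant.sum_mul_mul_eq_zero (hu : IsFlipInvariant u) (a b c : Fin 5) :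
    ∑ j, u j a * u j b * u j c = 0 := by
  obtain ⟨m, hm⟩ := exists_flipExcept_mul_mul_eq a b c
  obtain ⟨τ, hτ⟩ := hu m
  have hm' : ((flipExcept m a : ℤ) : ℝ) * ((flipExcept m b : ℤ) : ℝ) *
      ((flipExcept m c : ℤ) : ℝ) = -1 := by
    simpa using congrArg (fun w : ℤˣ => ((w : ℤ) : ℝ)) hm
  exact sum_eq_zero_of_perm τ fun j => by
    rw [hτ, hτ, hτ]
    linear_combination u j a * u j b * u j c * hm'

/-- A flip-invariant family of vectors of the same length with equal second moments integrates
`(s + ⟨p, ·⟩) ^ 3` like the sphere. -/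
theorem IsFlipInvariant.sum_add_pow_three (hu : IsFlipInvariant u)
    (heq : ∀ a b, ∑ j, u j a ^ 2 = ∑ j, u j b ^ 2) {r : ℝ} (hr : ∀ j, ∑ i, u j i ^ 2 = r)
    (s : ℝ) (p : Fin 5 → ℝ) :
    ∑ j, (s + ∑ i, p i * u j i) ^ 3 =
      Fintype.card ι * (s ^ 3 + 3 / 5 * s * ((∑ i, p i ^ 2) * r)) := by
  have h1 : ∑ j, ∑ i, p i * u j i = 0 := by
    rw [Finset.sum_comm]
    simp_rw [← Finset.mul_sum, hu.sum_eq_zero]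
    simp
  -- The five equal second moments add up to the number of vectors times r.
  have hsq (a : Fin 5) : ∑ j, u j a ^ 2 = Fintype.card ι * r / 5 := by
    have h : ∑ a, ∑ j, u j a ^ 2 = Fintype.card ι * r := by
      rw [Finset.sum_comm]
      simp [hr]
    rw [Finset.sum_congr rfl fun b _ => heq b a] at h
    simp at h
    linarith
  have h2 : ∑ j, (∑ i, p i * u j i) ^ 2 = (∑ i, p i ^ 2) * (Fintype.card ι * r / 5) := by
    have h (a b : Fin 5) : ∑ j, p a * u j a * (p b * u j b) =
        if a = b then p a ^ 2 * (Fintype.card ι * r / 5) else 0 := by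
      split_ifs with hab
      · subst hab
        rw [← hsq a, Finset.mul_sum]
        exact Finset.sum_congr rfl fun j _ => by ring
      · rw [← mul_zero (p a * p b), ← hu.sum_mul_eq_zero hab, Finset.mul_sum]
        exact Finset.sum_congr rfl fun j _ => by ring
    simp_rw [sq, Finset.sum_mul_sum]
    rw [Finset.sum_comm]
    refine (Finset.sum_congr rfl fun a _ =>
      Finset.sum_comm.trans (Finset.sum_congr rfl fun b _ => h a b)).trans ?_
    simp [Finset.sum_mul, sq]
  have h3 : ∑ j, (∑ i, p i * u j i) ^ 3 = 0 := by
    have h (a b c : Fin 5) : ∑ j, p a * u j a * (p b * u j b) * (p c * u j c) = 0 := by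
      rw [← mul_zero (p a * p b * p c), ← hu.sum_mul_mul_eq_zero a b c, Finset.mul_sum]
      exact Finset.sum_congr rfl fun j _ => by ring
    have hcube (j : ι) : (∑ i, p i * u j i) ^ 3 =
        ∑ a, ∑ b, ∑ c, p a * u j a * (p b * u j b) * (p c * u j c) := by
      rw [pow_three', Finset.sum_mul_sum, Finset.sum_mul]
      simp_rw [Finset.sum_mul, Finset.mul_sum]
    simp_rw [hcube]
    rw [Finset.sum_comm]
    refine Finset.sum_eq_zero fun a _ => ?_
    rw [Finset.sum_comm]
    refine Finset.sum_eq_zero fun b _ => ?_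
    rw [Finset.sum_comm]
    exact Finset.sum_eq_zero fun c _ => h a b c
  have hexp (j : ι) : (s + ∑ i, p i * u j i) ^ 3 = s ^ 3 + 3 * s ^ 2 * ∑ i, p i * u j i +
      3 * s * (∑ i, p i * u j i) ^ 2 + (∑ i, p i * u j i) ^ 3 := by ring
  simp_rw [hexp, Finset.sum_add_distrib, ← Finset.mul_sum, h1, h2, h3]
  simp
  ring

end Moments

theorem coe_mul_mulVec {d : ℕ} {G : Subgroup (U d)} (g h : G) (x : Vec d) :
    (((g * h : G) : U d) : Matrix (Fin d) (Fin d) ℍ[ℝ]) *ᵥ x =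
      ((g : U d) : Matrix (Fin d) (Fin d) ℍ[ℝ]) *ᵥ
        (((h : U d) : Matrix (Fin d) (Fin d) ℍ[ℝ]) *ᵥ x) := by
  rw [Matrix.mulVec_mulVec]
  rfl

namespace IsSignedPermCover

variable {G : Subgroup (U 2)} {H : Subgroup (Equiv.Perm (Fin 5))}

section Family

variable {ι : Type*} [Fintype ι] {v : ι → Vec 2}

/-- With s = ‖y‖²r², each summand is (s + hopf y · hopf v)³/8. Both Hopf images have lengths with
product s, so the average is (s³ + 3/5 s³)/8 = s³/5, which is where c₃(ℍ²) = 1/5 appears. -/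
theorem sum_norm_hInner (hG : IsSignedPermCover G H)
    (hperm : ∀ g ∈ G, ∃ τ : Equiv.Perm ι, ∀ j,
      hopf (v (τ j)) = hopf ((g : Matrix (Fin 2) (Fin 2) ℍ[ℝ]) *ᵥ v j))
    {r : ℝ} (hr : ∀ j, vecNorm (v j) = r) (y : Vec 2) :
    ∑ j, ‖hInner y (v j)‖ ^ (2 * 3) =
      Fintype.card ι * (designConst 3 2 * (vecNorm y * r) ^ (2 * 3)) := by
  have hflip : IsFlipInvariant fun j => hopf (v j) := fun m => by
    obtain ⟨g, hg, hgm⟩ := hG.exists_flipExcept m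
    obtain ⟨τ, hτ⟩ := hperm g hg
    exact ⟨τ, fun j i => (congrFun (hτ j) i).trans (hgm (v j) i)⟩
  have heq (a b : Fin 5) : ∑ j, hopf (v j) a ^ 2 = ∑ j, hopf (v j) b ^ 2 := by
    obtain ⟨σ, hσ, rfl⟩ := hG.transitive a b
    obtain ⟨g, hg, ε, hgε⟩ := hG.lift σ hσ
    obtain ⟨τ, hτ⟩ := hperm g hg
    rw [← Equiv.sum_comp τ fun j => hopf (v j) (σ a) ^ 2]
    refine Finset.sum_congr rfl fun j _ => ?_
    rw [hτ, hgε, mul_pow, sq ((ε a : ℤ) : ℝ), ActsBy.sign_mul_self, one_mul]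
  have h := hflip.sum_add_pow_three heq (r := (r ^ 2) ^ 2)
    (fun j => by rw [sum_hopf_sq, hr]) (vecNorm y ^ 2 * r ^ 2) (hopf y)
  rw [sum_hopf_sq] at h
  have hterm (j : ι) : ‖hInner y (v j)‖ ^ (2 * 3) =
      1 / 8 * (vecNorm y ^ 2 * r ^ 2 + ∑ i, hopf y i * hopf (v j) i) ^ 3 := by
    rw [← hr j, ← two_mul_norm_hInner_sq]
    ring
  simp_rw [hterm, ← Finset.mul_sum, h, designConst_three_two]
  ring

theorem isSphericalDesign (hG : IsSignedPermCover G H)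
    (hperm : ∀ g ∈ G, ∃ τ : Equiv.Perm ι, ∀ j,
      hopf (v (τ j)) = hopf ((g : Matrix (Fin 2) (Fin 2) ℍ[ℝ]) *ᵥ v j))
    (hv : ∀ j, vecNorm (v j) = 1) : IsSphericalDesign 3 v := by
  refine ⟨hv, ?_⟩
  simp_rw [hG.sum_norm_hInner hperm hv, hv]
  simp
  ring

end Family

theorem hopf_injective (hG : IsSignedPermCover G H) {g : U 2} (hg : g ∈ G) {x y : Vec 2}
    (h : hopf ((g : Matrix (Fin 2) (Fin 2) ℍ[ℝ]) *ᵥ x) =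
      hopf ((g : Matrix (Fin 2) (Fin 2) ℍ[ℝ]) *ᵥ y)) : hopf x = hopf y := by
  obtain ⟨ε, σ, -, hε, -⟩ := hG.acts g hg
  ext i
  have hi := congrFun h (σ i)
  rw [hε, hε] at hi
  exact mul_left_cancel₀ (by exact_mod_cast (ε i).ne_zero) hi

theorem isSphericalDesign_orbit (hG : IsSignedPermCover G H) [Fintype G] {x : Vec 2}
    (hx : x ≠ 0) : IsSphericalDesign 3 (fun g : G =>
      normalize (((g : U 2) : Matrix (Fin 2) (Fin 2) ℍ[ℝ]) *ᵥ x)) := by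
  refine hG.isSphericalDesign (fun g hg => ⟨Equiv.mulLeft ⟨g, hg⟩, fun j => ?_⟩)
    fun g => vecNorm_normalize (mulVec_ne_zero _ hx)
  simp only [Equiv.coe_mulLeft, normalize, vecNorm_mulVec, Matrix.mulVec_smul, coe_mul_mulVec]

theorem orbitPoly_eq_zero (hG : IsSignedPermCover G H) [Fintype G] (x : Vec 2) :
    orbitPoly 3 G x = 0 := by
  have h := hG.sum_norm_hInner (ι := G)
    (v := fun g => ((g : U 2) : Matrix (Fin 2) (Fin 2) ℍ[ℝ]) *ᵥ x)
    (fun g hg => ⟨Equiv.mulLeft ⟨g, hg⟩, fun j =>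
      congrArg hopf (coe_mul_mulVec ⟨g, hg⟩ j x)⟩)
    (fun g => vecNorm_mulVec g.1 x) x
  have hc : (Fintype.card G : ℝ) ≠ 0 := by exact_mod_cast Fintype.card_ne_zero
  rw [orbitPoly, h, inv_mul_cancel_left₀ hc]
  ring

/-- A finite set of lines that is invariant under `G` is a design. -/
theorem isLineDesign (hG : IsSignedPermCover G H) {S : Set (Line 2)} (hS : S.Finite)
    (hinv : ∀ g ∈ G, ∀ (x : Vec 2) (hx : x ≠ 0), lineOf x hx ∈ S →
      lineOf ((g : Matrix (Fin 2) (Fin 2) ℍ[ℝ]) *ᵥ x) (mulVec_ne_zero g hx) ∈ S) :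
    IsLineDesign 3 S := by
  have := hS.to_subtype
  let e := (Finite.equivFin S).symm
  let v : Fin (Nat.card S) → Vec 2 := fun j => normalize (e j).1.rep
  have hn (j) : vecNorm (v j) = 1 := vecNorm_normalize (Projectivization.rep_nonzero _)
  have hv (j) : v j ≠ 0 := ne_zero_of_vecNorm_eq_one (hn j)
  have hline (j) : lineOf (v j) (hv j) = (e j).1 :=
    (lineOf_normalize (Projectivization.rep_nonzero _)).trans (Projectivization.mk_rep _)
  refine ⟨_, v, hv, fun j k hjk => ?_, ?_, hG.isSphericalDesign (fun g hg => ?_) hn⟩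
  · simp only [hline] at hjk
    exact e.injective (Subtype.ext hjk)
  · simp_rw [hline]
    exact (e.surjective.range_comp Subtype.val).trans Subtype.range_val
  · have hmem (j) := hinv g hg (v j) (hv j) (by rw [hline]; exact (e j).2)
    -- `g` carries a chosen representative only to a scalar multiple of another one, which is why
    -- the permutation hypothesis is stated for Hopf images.
    let f : Fin (Nat.card S) → Fin (Nat.card S) := fun j => e.symm ⟨_, hmem j⟩
    have hf (j) : hopf (v (f j)) = hopf ((g : Matrix (Fin 2) (Fin 2) ℍ[ℝ]) *ᵥ v j) := by
      refine hopf_eq_of_lineOf (hv _) (mulVec_ne_zero g (hv j))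
        (by rw [vecNorm_mulVec, hn, hn]) ?_
      rw [hline]
      exact congrArg Subtype.val (e.apply_symm_apply ⟨_, hmem j⟩)
    have hinj : Function.Injective f := fun j k hjk => by
      have h : hopf (v j) = hopf (v k) := hG.hopf_injective hg (by rw [← hf, ← hf, hjk])
      have h1 := lineOf_eq_of_hopf (hv j) (hv k) (by rw [hn, hn]) h
      rw [hline, hline] at h1
      exact e.injective (Subtype.ext h1)
    exact ⟨Equiv.ofBijective f (Finite.injective_iff_bijective.1 hinj), hf⟩

theorem lineOf_mem_orbitLines {G : Subgroup (U 2)} {x : Vec 2} (hx : x ≠ 0) {g : U 2}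
    (hg : g ∈ G) {y : Vec 2} (hy : y ≠ 0) (h : lineOf y hy ∈ orbitLines G x hx) :
    lineOf ((g : Matrix (Fin 2) (Fin 2) ℍ[ℝ]) *ᵥ y) (mulVec_ne_zero g hy) ∈
      orbitLines G x hx := by
  obtain ⟨h, hh⟩ := h
  obtain ⟨q, hq⟩ := (Projectivization.mk_eq_mk_iff' _ _ _ _ _).1 hh
  refine ⟨⟨g, hg⟩ * h, (Projectivization.mk_eq_mk_iff' _ _ _ _ _).2 ⟨q, ?_⟩⟩
  rw [← Matrix.mulVec_smul, hq, coe_mul_mulVec]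

theorem isLineDesign_orbitLines (hG : IsSignedPermCover G H) {x : Vec 2} (hx : x ≠ 0) :
    IsLineDesign 3 (orbitLines G x hx) := by
  have := hG.finite
  exact hG.isLineDesign (Set.finite_range _) fun g hg y hy => lineOf_mem_orbitLines hx hg hy

/-- The ten lines of the five bases form a single orbit. -/
theorem orbitLines_mub (hG : IsSignedPermCover G H) (m : Fin 5) (a : Fin 2) :
    orbitLines G (mub m a) (mub_ne_zero m a) = mubLines := by
  apply Set.Subset.antisymm
  · rintro _ ⟨g, rfl⟩
    obtain ⟨ε, σ, -, hε, -⟩ := hG.acts g g.2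
    have h (s : ℝ) (hs : hopf (mub m a) = s • Pi.single m 1) :
        hopf (((g : U 2) : Matrix (Fin 2) (Fin 2) ℍ[ℝ]) *ᵥ mub m a) =
          (((ε m : ℤ) : ℝ) * s) • Pi.single (σ m) 1 := by
      ext i
      obtain ⟨i, rfl⟩ := σ.surjective i
      rw [hε, hs]
      by_cases him : i = m
      · subst him
        simp
      · simp [him]
    have h2 : hopf (((g : U 2) : Matrix (Fin 2) (Fin 2) ℍ[ℝ]) *ᵥ mub m a) = Pi.single (σ m) 1 ∨
        hopf (((g : U 2) : Matrix (Fin 2) (Fin 2) ℍ[ℝ]) *ᵥ mub m a) = -Pi.single (σ m) 1 := by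
      obtain rfl | rfl : a = 0 ∨ a = 1 := by omega
      · rw [h 1 (by rw [hopf_mub_zero, one_smul])]
        rcases Int.units_eq_one_or (ε m) with h | h <;> simp [h]
      · rw [h (-1) (by rw [hopf_mub_one, neg_one_smul])]
        rcases Int.units_eq_one_or (ε m) with h | h <;> simp [h]
    have hn (b : Fin 2) : vecNorm (mub (σ m) b) =
        vecNorm (((g : U 2) : Matrix (Fin 2) (Fin 2) ℍ[ℝ]) *ᵥ mub m a) := by
      rw [vecNorm_mulVec, vecNorm_mub, vecNorm_mub]
    rcases h2 with h2 | h2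
    · exact ⟨(σ m, 0), lineOf_eq_of_hopf _ _ (hn 0) (by rw [h2, hopf_mub_zero])⟩
    · exact ⟨(σ m, 1), lineOf_eq_of_hopf _ _ (hn 1) (by rw [h2, hopf_mub_one])⟩
  · rintro _ ⟨⟨n, b⟩, rfl⟩
    obtain ⟨σ, hσ, rfl⟩ := hG.transitive m n
    obtain ⟨g, hg, ε, hε⟩ := hG.lift σ hσ
    obtain ⟨w, hw⟩ : ∃ w : ℤˣ, ∀ i, ((w : ℤ) : ℝ) * hopf (mub m a) i =
        hopf (mub (σ m) b) (σ i) := by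
      have hs (i : Fin 5) : (Pi.single (σ m) 1 : Fin 5 → ℝ) (σ i) =
          (Pi.single m 1 : Fin 5 → ℝ) i := by
        simp [Pi.single_apply]
      obtain rfl | rfl : a = 0 ∨ a = 1 := by omega
      all_goals obtain rfl | rfl : b = 0 ∨ b = 1 := by omega
      · exact ⟨1, fun i => by simp [hopf_mub_zero, hs]⟩
      · exact ⟨-1, fun i => by simp [hopf_mub_zero, hopf_mub_one, hs]⟩
      · exact ⟨-1, fun i => by simp [hopf_mub_zero, hopf_mub_one, hs]⟩
      · exact ⟨1, fun i => by simp [hopf_mub_one, hs]⟩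
    -- `g` moves the axis m correctly but with sign ε m instead of w. An even sign change applied
    -- first corrects this; its other entries act on zero coordinates.
    obtain ⟨δ, hδ, hδm⟩ := exists_even_signs (w * ε m) m
    obtain ⟨s, hs, hsδ⟩ := hG.exists_signs δ hδ
    have hgs := hε.mul hsδ
    refine ⟨⟨g * s, G.mul_mem hg hs⟩, lineOf_eq_of_hopf _ _ ?_ ?_⟩
    · rw [vecNorm_mulVec, vecNorm_mub, vecNorm_mub]
    · ext i
      obtain ⟨i, rfl⟩ := σ.surjective i
      refine (hgs (mub m a) i).trans ?_
      rw [← hw]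
      by_cases him : i = m
      · subst him
        simp only [Equiv.Perm.one_apply, hδm]
        rw [mul_left_comm, Int.units_mul_self, mul_one]
      · have h0 : hopf (mub m a) i = 0 := by
          obtain rfl | rfl : a = 0 ∨ a = 1 := by omega
          · simp [hopf_mub_zero, him]
          · simp [hopf_mub_one, him]
        rw [h0, mul_zero, mul_zero]

end IsSignedPermCover

/-! ### The five bases: unbiasedness and number of lines -/

theorem isMUB_mub : IsMUB mub := by
  have hsq (m n a b) := two_mul_norm_hInner_sq (mub m a) (mub n b)
  simp only [vecNorm_mub, one_pow, mul_one] at hsq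
  refine ⟨fun m a b => ?_, fun m n hmn a b => ?_⟩
  · split_ifs with hab
    · subst hab
      rw [hInner_self, vecNorm_mub, one_pow, Quaternion.coe_one]
    -- Antipodal Hopf images mean orthogonal vectors; orthogonal Hopf images, in the next case, mean
    -- |⟨v,w⟩|² = 1/2.
    · have h : ∑ i, hopf (mub m a) i * hopf (mub m b) i = -1 := by
        obtain rfl | rfl : a = 0 ∨ a = 1 := by omega
        all_goals obtain rfl | rfl : b = 0 ∨ b = 1 := by omega
        all_goals first | exact absurd rfl hab |
          simp [hopf_mub_zero, hopf_mub_one, Pi.single_apply]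
      have h1 := hsq m m a b
      rw [h, add_neg_cancel, mul_eq_zero_iff_left two_ne_zero, sq_eq_zero_iff, norm_eq_zero] at h1
      exact h1
  · have h : ∑ i, hopf (mub m a) i * hopf (mub n b) i = 0 := by
      obtain rfl | rfl : a = 0 ∨ a = 1 := by omega
      all_goals obtain rfl | rfl : b = 0 ∨ b = 1 := by omega
      all_goals simp [hopf_mub_zero, hopf_mub_one, Pi.single_apply, hmn.symm]
    have h1 := hsq m n a b
    rw [h, add_zero] at h1
    push_cast
    linarith

theorem ncard_mubLines : mubLines.ncard = 10 := by
  have hinj : Function.Injective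
      fun p : Fin 5 × Fin 2 => lineOf (mub p.1 p.2) (mub_ne_zero p.1 p.2) := by
    rintro ⟨m, a⟩ ⟨n, b⟩ h
    have h1 := hopf_eq_of_lineOf _ _ (by rw [vecNorm_mub, vecNorm_mub]) h
    have h2 := congrFun h1 n
    have hmn : m = n := by
      by_contra hmn
      obtain rfl | rfl : a = 0 ∨ a = 1 := by omega
      all_goals obtain rfl | rfl : b = 0 ∨ b = 1 := by omega
      all_goals simp [hopf_mub_zero, hopf_mub_one, Ne.symm hmn] at h2
    subst hmn
    obtain rfl | rfl : a = 0 ∨ a = 1 := by omega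
    all_goals obtain rfl | rfl : b = 0 ∨ b = 1 := by omega
    all_goals first | rfl | norm_num [hopf_mub_zero, hopf_mub_one] at h2
  rw [mubLines, ← Set.image_univ, Set.ncard_image_of_injective _ hinj, Set.ncard_univ,
    Nat.card_eq_fintype_card]
  rfl

/-! ### The groups `P₁`, `P₂`, `P₃` -/

/-- Multiplying x₀ by i on the left multiplies x₁x₀* by -i on the right and preserves both moduli.
This permutes the four quaternion coordinates up to sign. -/
theorem actsBy_matI : ActsBy ⟨matI, matI_mem⟩ ![1, -1, 1, 1, -1]
    (Equiv.swap 1 2 * Equiv.swap 3 4) := by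
  intro x i
  have h0 : (matI *ᵥ x) 0 = qi * x 0 := by simp [matI, Matrix.mulVec, dotProduct]
  have h1 : (matI *ᵥ x) 1 = x 1 := by simp [matI, Matrix.mulVec, dotProduct]
  fin_cases i <;>
    simp [hopf, h0, h1, Quaternion.normSq_def', qi_re, qi_imI, qi_imJ, qi_imK,
      Equiv.swap_apply_def] <;> ring

theorem actsBy_matJ : ActsBy ⟨matJ, matJ_mem⟩ ![1, -1, -1, 1, 1]
    (Equiv.swap 1 3 * Equiv.swap 2 4) := by
  intro x i
  have h0 : (matJ *ᵥ x) 0 = qj * x 0 := by simp [matJ, Matrix.mulVec, dotProduct]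
  have h1 : (matJ *ᵥ x) 1 = x 1 := by simp [matJ, Matrix.mulVec, dotProduct]
  fin_cases i <;>
    simp [hopf, h0, h1, Quaternion.normSq_def', qj_re, qj_imI, qj_imJ, qj_imK,
      Equiv.swap_apply_def] <;> ring

theorem actsBy_matR : ActsBy ⟨matR, matR_mem⟩ ![1, 1, -1, -1, 1]
    (Equiv.swap 0 3 * Equiv.swap 2 4) := by
  intro x i
  have h : matR *ᵥ x = (1 / 2 : ℝ) • ![(1 + qj) * x 0 + (-1 + qj) * x 1,
      (-1 + qj) * x 0 + (1 + qj) * x 1] := by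
    rw [matR, Matrix.smul_mulVec]
    simp [dotProduct]
  rw [h, hopf_smul]
  fin_cases i <;>
    simp [hopf, Quaternion.normSq_def', qj_re, qj_imI, qj_imJ, qj_imK,
      Equiv.swap_apply_def] <;> ring

theorem actsBy_matF : ActsBy ⟨matF, matF_mem⟩ ![1, 1, -1, -1, -1] (Equiv.swap 0 1) := by
  intro x i
  have h : matF *ᵥ x = (1 / √2 : ℝ) • ![x 0 + x 1, x 0 - x 1] := by
    rw [matF, Matrix.smul_mulVec]
    simp [dotProduct, sub_eq_add_neg]
  rw [h, hopf_smul]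
  fin_cases i <;>
    simp [hopf, Quaternion.normSq_def', Equiv.swap_apply_def] <;> ring

theorem isReflection_matI : IsReflection matI := by
  refine ⟨fun h => ?_, isOfFinOrder_iff_pow_eq_one.2 ⟨4, by norm_num, ?_⟩, ![1, 0], by simp,
    fun x hx => ?_⟩
  · have := congrArg (fun g => (g 0 0).re) h
    simp [matI, qi_re] at this
  · have h2 : matI ^ 2 = !![-1, 0; 0, 1] := by
      simp [sq, matI, qi_mul_qi]
    rw [show 4 = 2 * 2 from rfl, pow_mul, h2, sq, Matrix.one_fin_two]
    simp
  · have h0 : x 0 = 0 := by simpa [hInner] using hx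
    ext1 i
    fin_cases i <;> simp [matI, Matrix.mulVec, dotProduct, h0]

theorem isReflection_matJ : IsReflection matJ := by
  refine ⟨fun h => ?_, isOfFinOrder_iff_pow_eq_one.2 ⟨4, by norm_num, ?_⟩, ![1, 0], by simp,
    fun x hx => ?_⟩
  · have := congrArg (fun g => (g 0 0).re) h
    simp [matJ, qj_re] at this
  · have h2 : matJ ^ 2 = !![-1, 0; 0, 1] := by
      simp [sq, matJ, qj_mul_qj]
    rw [show 4 = 2 * 2 from rfl, pow_mul, h2, sq, Matrix.one_fin_two]
    simp
  · have h0 : x 0 = 0 := by simpa [hInner] using hx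
    ext1 i
    fin_cases i <;> simp [matJ, Matrix.mulVec, dotProduct, h0]

theorem matR_sq : matR ^ 2 = !![0, -1; -1, 0] := by
  rw [sq, matR, smul_mul_smul_comm]
  ext1 i j
  fin_cases i <;> fin_cases j <;> simp [mul_add, add_mul, qj_mul_qj] <;> module

theorem isReflection_matR : IsReflection matR := by
  refine ⟨fun h => ?_, isOfFinOrder_iff_pow_eq_one.2 ⟨4, by norm_num, ?_⟩, ![1, 1], by simp,
    fun x hx => ?_⟩
  · have := congrArg (fun g => (g 0 0).imJ) h
    simp [matR, qj_imJ] at this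
  · rw [show 4 = 2 * 2 from rfl, pow_mul, matR_sq, sq, Matrix.one_fin_two]
    simp
  · have h0 : x 0 + x 1 = 0 := by simpa [hInner] using hx
    have h1 : x 1 = -x 0 := eq_neg_of_add_eq_zero_right h0
    rw [matR, Matrix.smul_mulVec]
    ext1 i
    fin_cases i <;> simp [dotProduct, h1, add_mul] <;> module

theorem isReflection_matF : IsReflection matF := by
  have h2 : (√2 : ℝ) * √2 = 2 := Real.mul_self_sqrt (by norm_num)
  -- The root (1 - √2, 1) is an eigenvector for -1; its orthogonal complement is spanned by (1, √2 -
  -- 1), of eigenvalue 1.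
  refine ⟨fun h => ?_, isOfFinOrder_iff_pow_eq_one.2 ⟨2, by norm_num, ?_⟩,
    ![((1 - √2 : ℝ) : ℍ[ℝ]), 1], fun h => one_ne_zero (congrFun h 1), fun x hx => ?_⟩
  · have := congrArg (fun g => (g 0 1).re) h
    simp [matF] at this
  · have h := Unitary.star_mul_self_of_mem matF_mem
    rwa [show star matF = matF from ?_, ← sq] at h
    rw [Matrix.star_eq_conjTranspose]
    ext1 i j
    fin_cases i <;> fin_cases j <;> simp [matF, Matrix.conjTranspose_apply]
  · have h0 : x 1 = (√2 - 1 : ℝ) • x 0 := by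
      have h : ((1 - √2 : ℝ) : ℍ[ℝ]) * x 0 + x 1 = 0 := by
        simpa [hInner] using hx
      rw [Quaternion.coe_mul_eq_smul] at h
      rw [eq_neg_of_add_eq_zero_right h]
      module
    have h3 : (√2)⁻¹ + (√2)⁻¹ * (√2 - 1) = 1 := by field_simp; ring
    have h4 : (√2)⁻¹ - (√2)⁻¹ * (√2 - 1) = √2 - 1 := by
      field_simp
      linear_combination -h2
    rw [matF, Matrix.smul_mulVec]
    ext1 i
    fin_cases i
    · simp only [Fin.zero_eta, Pi.smul_apply, Matrix.mulVec_fin_two, Matrix.of_apply,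
        Matrix.cons_val', Matrix.cons_val_zero, Matrix.cons_val_one, Matrix.cons_val_fin_one,
        h0, one_mul, smul_add, smul_smul, ← add_smul, one_div, h3, one_smul]
    · simp only [Fin.mk_one, Pi.smul_apply, Matrix.mulVec_fin_two, Matrix.of_apply,
        Matrix.cons_val', Matrix.cons_val_zero, Matrix.cons_val_one, Matrix.cons_val_fin_one,
        h0, one_mul, neg_mul, ← sub_eq_add_neg, smul_sub, smul_smul, one_div]
      rw [← sub_smul, h4]

/-! ### The permutation groups -/

/-- The permutation of the five coordinates induced by `matI`. -/
def permI : Equiv.Perm (Fin 5) := Equiv.swap 1 2 * Equiv.swap 3 4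

/-- The permutation of the five coordinates induced by `matJ`. -/
def permJ : Equiv.Perm (Fin 5) := Equiv.swap 1 3 * Equiv.swap 2 4

/-- The permutation of the five coordinates induced by `matR`. -/
def permR : Equiv.Perm (Fin 5) := Equiv.swap 0 3 * Equiv.swap 2 4

/-- The permutation of the five coordinates induced by `matF`. -/
def permF : Equiv.Perm (Fin 5) := Equiv.swap 0 1

theorem transitive_of_five_cycle {H : Subgroup (Equiv.Perm (Fin 5))} {c : Equiv.Perm (Fin 5)}
    (hc : c ∈ H) (h : ∀ i j, ∃ n : Fin 5, (c ^ (n : ℕ)) i = j) (i j : Fin 5) :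
    ∃ σ ∈ H, σ i = j := by
  obtain ⟨n, hn⟩ := h i j
  exact ⟨c ^ (n : ℕ), H.pow_mem hc _, hn⟩

/-- A block size divides the degree, which is the prime 5. Primitivity is what Jordan's theorems on
three-cycles and transpositions need below. -/
theorem isPreprimitive_of_transitive {H : Subgroup (Equiv.Perm (Fin 5))}
    (h : ∀ i j, ∃ σ ∈ H, σ i = j) : MulAction.IsPreprimitive H (Fin 5) := by
  have : MulAction.IsPretransitive H (Fin 5) :=
    ⟨fun i j => by
      obtain ⟨σ, hσ, hij⟩ := h i j
      exact ⟨⟨σ, hσ⟩, hij⟩⟩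
  exact MulAction.IsPreprimitive.of_prime_card (by rw [Nat.card_fin]; exact Nat.prime_five)

theorem transitive_closure_IR (i j : Fin 5) :
    ∃ σ ∈ Subgroup.closure {permI, permR}, σ i = j :=
  transitive_of_five_cycle (c := permI * permR)
    (mul_mem (Subgroup.subset_closure (by simp)) (Subgroup.subset_closure (by simp)))
    (by decide) i j

theorem transitive_closure_IJR (i j : Fin 5) :
    ∃ σ ∈ Subgroup.closure {permI, permJ, permR}, σ i = j :=
  transitive_of_five_cycle (c := permI * permR)
    (mul_mem (Subgroup.subset_closure (by simp)) (Subgroup.subset_closure (by simp)))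
    (by decide) i j

theorem transitive_closure_IJF (i j : Fin 5) :
    ∃ σ ∈ Subgroup.closure {permI, permJ, permF}, σ i = j :=
  transitive_of_five_cycle (c := permI * permF * (permJ * permF))
    (mul_mem (mul_mem (Subgroup.subset_closure (by simp)) (Subgroup.subset_closure (by simp)))
      (mul_mem (Subgroup.subset_closure (by simp)) (Subgroup.subset_closure (by simp))))
    (by decide) i j

set_option maxRecDepth 4000 in
theorem natCard_closure_IR : Nat.card (Subgroup.closure {permI, permR}) = 10 := by
  -- Two involutions whose product has order five generate a dihedral group; this is its normal
  -- form, a rotation times a power of a reflection.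
  let f : Fin 5 × Fin 2 → Equiv.Perm (Fin 5) :=
    fun p => (permI * permR) ^ (p.1 : ℕ) * permI ^ (p.2 : ℕ)
  have hI : permI ∈ Subgroup.closure {permI, permR} := Subgroup.subset_closure (by simp)
  have hR : permR ∈ Subgroup.closure {permI, permR} := Subgroup.subset_closure (by simp)
  have hf : (Subgroup.closure {permI, permR} : Set (Equiv.Perm (Fin 5))) = Set.range f := by
    apply Set.Subset.antisymm
    · intro σ hσ
      rw [SetLike.mem_coe, ← Subgroup.mem_toSubmonoid, Subgroup.closure_toSubmonoid_of_finite]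
        at hσ
      induction hσ using Submonoid.closure_induction_left with
      | one => exact ⟨0, by decide⟩
      | mul_left x hx y _ hy =>
        obtain ⟨p, rfl⟩ := hy
        have hmul : (∀ p, ∃ q, f q = permI * f p) ∧ ∀ p, ∃ q, f q = permR * f p := by
          decide
        rcases hx with rfl | rfl
        exacts [hmul.1 p, hmul.2 p]
    · rintro _ ⟨p, rfl⟩
      exact mul_mem (pow_mem (mul_mem hI hR) _) (pow_mem hI _)
  have hinj : Function.Injective f := by decide
  rw [← SetLike.coe_sort_coe, hf, Nat.card_range_of_injective hinj, Nat.card_eq_fintype_card]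
  rfl

theorem natCard_closure_IJR : Nat.card (Subgroup.closure {permI, permJ, permR}) = 60 := by
  have h : Subgroup.closure {permI, permJ, permR} = alternatingGroup (Fin 5) := by
    apply le_antisymm
    · rw [Subgroup.closure_le]
      rintro σ (rfl | rfl | rfl) <;> exact Equiv.Perm.mem_alternatingGroup.2 (by decide)
    -- The common factor (2 4) cancels in `permJ * permR`, which leaves a three-cycle on 0, 1, 3.
    · refine Equiv.Perm.alternatingGroup_le_of_isPreprimitive_of_isThreeCycle_mem
        (isPreprimitive_of_transitive transitive_closure_IJR) (g := permJ * permR)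
        (card_support_eq_three_iff.1 (by decide))
        (mul_mem (Subgroup.subset_closure (by simp)) (Subgroup.subset_closure (by simp)))
  rw [h, nat_card_alternatingGroup, Nat.card_fin]
  rfl

theorem natCard_closure_IJF : Nat.card (Subgroup.closure {permI, permJ, permF}) = 120 := by
  have h : Subgroup.closure {permI, permJ, permF} = ⊤ :=
    Equiv.Perm.subgroup_eq_top_of_isPreprimitive_of_isSwap_mem
      (isPreprimitive_of_transitive transitive_closure_IJF) (g := permF)
      ⟨0, 1, by decide, rfl⟩ (Subgroup.subset_closure (by simp))
  rw [h, Subgroup.card_top, Nat.card_perm, Nat.card_fin]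
  rfl

/-! ### From generators to the three signed permutation covers -/

theorem isSignedPermCover_closure {S : Set (U 2)} {T : Set (Equiv.Perm (Fin 5))}
    (hS : ∀ g ∈ S, ∃ ε, ∃ σ ∈ T, ActsBy g ε σ ∧ (∏ i, ε i) * Equiv.Perm.sign σ = 1)
    (hT : ∀ σ ∈ T, ∃ g ∈ S, ∃ ε, ActsBy g ε σ)
    (htrans : ∀ i j, ∃ σ ∈ Subgroup.closure T, σ i = j)
    {s t : U 2} (hs : s ∈ Subgroup.closure S) (ht : t ∈ Subgroup.closure S)
    (hs' : (s : Matrix (Fin 2) (Fin 2) ℍ[ℝ]) = !![-1, 0; 0, 1])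
    (ht' : (t : Matrix (Fin 2) (Fin 2) ℍ[ℝ]) = !![0, -1; -1, 0]) :
    IsSignedPermCover (Subgroup.closure S) (Subgroup.closure T) where
  acts g hg := by
    induction hg using Subgroup.closure_induction with
    | mem g hg =>
      obtain ⟨ε, σ, hσ, h⟩ := hS g hg
      exact ⟨ε, σ, Subgroup.subset_closure hσ, h⟩
    | one => exact ⟨1, 1, one_mem _, ActsBy.one, by simp⟩
    | mul a b _ _ ha hb =>
      obtain ⟨ε, σ, hσ, h, hp⟩ := ha
      obtain ⟨δ, τ, hτ, h', hp'⟩ := hb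
      -- Reindexing the signs by τ leaves their product unchanged, so the determinant is
      -- multiplicative.
      refine ⟨_, _, mul_mem hσ hτ, h.mul h', ?_⟩
      rw [Finset.prod_mul_distrib, Equiv.prod_comp τ ε, Equiv.Perm.sign_mul,
        mul_mul_mul_comm, hp, hp', one_mul]
    | inv a _ ha =>
      obtain ⟨ε, σ, hσ, h, hp⟩ := ha
      refine ⟨_, _, inv_mem hσ, h.inv, ?_⟩
      rw [Equiv.prod_comp σ⁻¹ ε, Equiv.Perm.sign_inv, hp]
  lift σ hσ := by
    induction hσ using Subgroup.closure_induction with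
    | mem σ hσ =>
      obtain ⟨g, hg, h⟩ := hT σ hσ
      exact ⟨g, Subgroup.subset_closure hg, h⟩
    | one => exact ⟨1, one_mem _, 1, ActsBy.one⟩
    | mul a b _ _ ha hb =>
      obtain ⟨g, hg, ε, h⟩ := ha
      obtain ⟨g', hg', ε', h'⟩ := hb
      exact ⟨_, mul_mem hg hg', _, h.mul h'⟩
    | inv a _ ha =>
      obtain ⟨g, hg, ε, h⟩ := ha
      exact ⟨_, inv_mem hg, _, h.inv⟩
  transitive := htrans
  neg_one_mem := by
    have h : (s * t) * (s * t) = -1 := by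
      refine Subtype.ext ?_
      rw [coe_neg_one, Submonoid.coe_mul, Submonoid.coe_mul, hs', ht', Matrix.one_fin_two]
      simp
    rw [← h]
    exact mul_mem (mul_mem hs ht) (mul_mem hs ht)
  flip_mem := by
    -- diag(-1, 1) negates x₁x₀* and keeps the moduli, so only coordinate 0 survives unflipped.
    refine ⟨s, hs, 0, fun x i => ?_⟩
    have h0 : ((s : Matrix (Fin 2) (Fin 2) ℍ[ℝ]) *ᵥ x) 0 = -x 0 := by
      simp [hs', Matrix.mulVec, dotProduct]
    have h1 : ((s : Matrix (Fin 2) (Fin 2) ℍ[ℝ]) *ᵥ x) 1 = x 1 := by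
      simp [hs', Matrix.mulVec, dotProduct]
    fin_cases i <;> simp [hopf, h0, h1, flipExcept] <;> ring

theorem matI_sq : matI * matI = !![-1, 0; 0, 1] := by
  simp [matI, qi_mul_qi]

theorem isSignedPermCover_P₁ : IsSignedPermCover P₁ (Subgroup.closure {permI, permR}) := by
  have hI : ⟨matI, matI_mem⟩ ∈ P₁ := Subgroup.subset_closure (by simp)
  have hR : ⟨matR, matR_mem⟩ ∈ P₁ := Subgroup.subset_closure (by simp)
  refine isSignedPermCover_closure ?_ ?_ transitive_closure_IR (mul_mem hI hI) (mul_mem hR hR)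
    matI_sq ((sq matR).symm.trans matR_sq)
  · rintro g (rfl | rfl)
    · exact ⟨_, permI, by simp, actsBy_matI, by decide⟩
    · exact ⟨_, permR, by simp, actsBy_matR, by decide⟩
  · rintro g (rfl | rfl)
    · exact ⟨_, by simp, _, actsBy_matI⟩
    · exact ⟨_, by simp, _, actsBy_matR⟩

theorem isSignedPermCover_P₂ :
    IsSignedPermCover P₂ (Subgroup.closure {permI, permJ, permR}) := by
  have hI : ⟨matI, matI_mem⟩ ∈ P₂ := Subgroup.subset_closure (by simp)
  have hR : ⟨matR, matR_mem⟩ ∈ P₂ := Subgroup.subset_closure (by simp)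
  refine isSignedPermCover_closure ?_ ?_ transitive_closure_IJR (mul_mem hI hI) (mul_mem hR hR)
    matI_sq ((sq matR).symm.trans matR_sq)
  · rintro g (rfl | rfl | rfl)
    · exact ⟨_, permI, by simp, actsBy_matI, by decide⟩
    · exact ⟨_, permJ, by simp, actsBy_matJ, by decide⟩
    · exact ⟨_, permR, by simp, actsBy_matR, by decide⟩
  · rintro g (rfl | rfl | rfl)
    · exact ⟨_, by simp, _, actsBy_matI⟩
    · exact ⟨_, by simp, _, actsBy_matJ⟩
    · exact ⟨_, by simp, _, actsBy_matR⟩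

theorem matF_mul_matI_sq_mul_matF : matF * (matI * matI) * matF = !![0, -1; -1, 0] := by
  have h : (√2 : ℝ)⁻¹ * (√2)⁻¹ = 1 / 2 := by
    rw [← mul_inv, Real.mul_self_sqrt (by norm_num)]; norm_num
  rw [matI_sq, matF, smul_mul_assoc, smul_mul_smul_comm, one_div, h]
  ext1 i j
  fin_cases i <;> fin_cases j <;> simp <;> module

theorem isSignedPermCover_P₃ :
    IsSignedPermCover P₃ (Subgroup.closure {permI, permJ, permF}) := by
  have hI : ⟨matI, matI_mem⟩ ∈ P₃ := Subgroup.subset_closure (by simp)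
  have hF : ⟨matF, matF_mem⟩ ∈ P₃ := Subgroup.subset_closure (by simp)
  refine isSignedPermCover_closure ?_ ?_ transitive_closure_IJF (mul_mem hI hI)
    (mul_mem (mul_mem hF (mul_mem hI hI)) hF) matI_sq matF_mul_matI_sq_mul_matF
  · rintro g (rfl | rfl | rfl)
    · exact ⟨_, permI, by simp, actsBy_matI, by decide⟩
    · exact ⟨_, permJ, by simp, actsBy_matJ, by decide⟩
    · exact ⟨_, permF, by simp, actsBy_matF, by decide⟩
  · rintro g (rfl | rfl | rfl)
    · exact ⟨_, by simp, _, actsBy_matI⟩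
    · exact ⟨_, by simp, _, actsBy_matJ⟩
    · exact ⟨_, by simp, _, actsBy_matF⟩

theorem closure_reflections {d : ℕ} {S : Set (U d)}
    (hS : ∀ g ∈ S, IsReflection (g : Matrix (Fin d) (Fin d) ℍ[ℝ])) :
    Subgroup.closure {g : U d | g ∈ Subgroup.closure S ∧
      IsReflection (g : Matrix (Fin d) (Fin d) ℍ[ℝ])} = Subgroup.closure S :=
  le_antisymm ((Subgroup.closure_le _).2 fun _ hg => hg.1)
    (Subgroup.closure_mono fun g hg => ⟨Subgroup.subset_closure hg, hS g hg⟩)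

theorem IsSignedPermCover.design_properties {G : Subgroup (U 2)}
    {H : Subgroup (Equiv.Perm (Fin 5))} (hG : IsSignedPermCover G H) {n : ℕ}
    (hn : 32 * Nat.card H = n) :
    ∃ _ : Fintype G, Fintype.card G = n ∧
      (∀ (x : Vec 2) (hx : x ≠ 0),
        IsSphericalDesign 3 (fun g : G =>
          normalize (((g : U 2) : Matrix (Fin 2) (Fin 2) ℍ[ℝ]) *ᵥ x)) ∧
        IsLineDesign 3 (orbitLines G x hx)) ∧
      (∀ x : Vec 2, orbitPoly 3 G x = 0) ∧
      (∀ (m : Fin 5) (a : Fin 2), orbitLines G (mub m a) (mub_ne_zero m a) = mubLines) := by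
  have := hG.finite
  let _ := Fintype.ofFinite G
  refine ⟨inferInstance, ?_, fun x hx => ⟨hG.isSphericalDesign_orbit hx,
    hG.isLineDesign_orbitLines hx⟩, hG.orbitPoly_eq_zero, hG.orbitLines_mub⟩
  rw [Fintype.card_eq_nat_card, hG.natCard_eq, hn]

end QDesign

end

theorem mainTheorem1 :
    (∀ p ∈ ({(QDesign.P₁, 320), (QDesign.P₂, 1920), (QDesign.P₃, 3840)} :
        Set (Subgroup (QDesign.U 2) × ℕ)),
      -- the group is generated by the reflections that it contains
      Subgroup.closure {g : QDesign.U 2 | g ∈ p.1 ∧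
          QDesign.IsReflection (g : Matrix (Fin 2) (Fin 2) ℍ[ℝ])} = p.1 ∧
      -- the group is finite, of the given order
      ∃ _ : Fintype p.1, Fintype.card p.1 = p.2 ∧
        -- every orbit of a nonzero vector is a design, both as the family indexed by the group
        -- and as a set of lines
        (∀ (x : QDesign.Vec 2) (hx : x ≠ 0),
          QDesign.IsSphericalDesign 3 (fun g : p.1 =>
            QDesign.normalize
              (((g : QDesign.U 2) : Matrix (Fin 2) (Fin 2) ℍ[ℝ]) *ᵥ x)) ∧
          QDesign.IsLineDesign 3 (QDesign.orbitLines p.1 x hx)) ∧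
        -- the group average identity
        (∀ x : QDesign.Vec 2, QDesign.orbitPoly 3 p.1 x = 0) ∧
        -- the ten lines of the five bases are the orbit of each of them
        (∀ (m : Fin 5) (a : Fin 2),
          QDesign.orbitLines p.1 (QDesign.mub m a) (QDesign.mub_ne_zero m a) =
            QDesign.mubLines)) ∧
    -- the special case of the five mutually unbiased bases
    QDesign.IsMUB QDesign.mub ∧ QDesign.mubLines.ncard = 10 ∧
      QDesign.IsLineDesign 3 QDesign.mubLines := by
  refine ⟨?_, QDesign.isMUB_mub, QDesign.ncard_mubLines, ?_⟩
  · rintro p (rfl | rfl | rfl)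
    · refine ⟨QDesign.closure_reflections ?_, QDesign.isSignedPermCover_P₁.design_properties
        (by rw [QDesign.natCard_closure_IR])⟩
      rintro g (rfl | rfl)
      exacts [QDesign.isReflection_matI, QDesign.isReflection_matR]
    · refine ⟨QDesign.closure_reflections ?_, QDesign.isSignedPermCover_P₂.design_properties
        (by rw [QDesign.natCard_closure_IJR])⟩
      rintro g (rfl | rfl | rfl)
      exacts [QDesign.isReflection_matI, QDesign.isReflection_matJ, QDesign.isReflection_matR]
    · refine ⟨QDesign.closure_reflections ?_, QDesign.isSignedPermCover_P₃.design_properties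
        (by rw [QDesign.natCard_closure_IJF])⟩
      rintro g (rfl | rfl | rfl)
      exacts [QDesign.isReflection_matI, QDesign.isReflection_matJ, QDesign.isReflection_matF]
  -- Any of the three groups would serve: the ten lines are one orbit.
  · rw [← QDesign.isSignedPermCover_P₁.orbitLines_mub 0 0]
    exact QDesign.isSignedPermCover_P₁.isLineDesign_orbitLines _
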